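/- Let $n$ be a natural number and let $\mathcal K^n$ be the set of convex bodies (nonempty compact convex subsets) of Euclidean space $\mathbb R^n$, with closed unit ball $B$ and unit sphere $\mathbb S^{n-1}$. For $K\in\mathcal K^n$ let $S_{n-1}(K)$ denote its surface area measure, i.e. the unique Borel measure on $\mathbb S^{n-1}$ such that for every Borel set $\omega\subseteq\mathbb S^{n-1}$ \[ S_{n-1}(K)(\omega)=\lim_{\rho\to0^+}\frac1\rho\,\mathrm{Vol}\bigl(\{x\in\mathbb R^n : 0<d(x,K)\le\rho,\ \tfrac{x-p_K(x)}{d(x,K)}\in\omega\}\bigr), \] where $p_K(x)$ is the point of $K$ nearest to $x$ and $d(x,K)$ is the distance from $x$ to $K$. Let $V:\mathcal K^n\to\mathbb R$ be a valuation, that is, $V(K\cup L)+V(K\cap L)=V(K)+V(L)$ whenever $K,L,K\cup L\in\mathcal K^n$, and suppose that $V$ is bounded on $\{K\in\mathcal K^n:K\subseteq B\}$. Let $f:\mathbb S^{n-1}\to\mathbb R$ be a function which is integrable with respect to $S_{n-1}(K)$ for every $K\in\mathcal K^n$ and satisfies \[ V(K)=\int_{\mathbb S^{n-1}} f\,\mathrm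 dS_{n-1}(K)\qquad\text{for every }K\in\mathcal K^n . \] If $V(P)=0$ for every polytope $P$ (convex hull of a nonempty finite set of points), then $f$ is continuous, $f$ is the restriction of a linear function (there is $a\in\mathbb R^n$ with $f(u)=\langle a,u\rangle$ for all $u\in\mathbb S^{n-1}$), and $V(K)=0$ for every $K\in\mathcal K^n$. -/

import Mathlib

open Set Filter Topology MeasureTheory Metric
open scoped ENNReal RealInnerProductSpace

noncomputable section

namespace SurfaceArea

/-- A real function on convex bodies (nonempty compact convex sets) is a *valuation* if
`V (K ∪ L) + V (K ∩ L) = V K + V L` whenever `K ∪ L` is convex. The intersection is then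
nonempty, hence again a convex body. -/
def IsValuation {n : ℕ} (V : ConvexBody (EuclideanSpace ℝ (Fin n)) → ℝ) : Prop :=
  ∀ K L U I : ConvexBody (EuclideanSpace ℝ (Fin n)),
    (U : Set (EuclideanSpace ℝ (Fin n))) = (K : Set (EuclideanSpace ℝ (Fin n))) ∪ L →
    (I : Set (EuclideanSpace ℝ (Fin n))) = (K : Set (EuclideanSpace ℝ (Fin n))) ∩ L →
    V U + V I = V K + V L

/-- `V` is bounded on the convex bodies contained in the closed Euclidean unit ball. -/
def IsBoundedOnUnitBall {n : ℕ} (V : ConvexBody (EuclideanSpace ℝ (Fin n)) → ℝ) : Prop :=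
  ∃ C : ℝ, ∀ K : ConvexBody (EuclideanSpace ℝ (Fin n)),
    (K : Set (EuclideanSpace ℝ (Fin n))) ⊆ closedBall 0 1 → |V K| ≤ C

/-- A *polytope* is a convex body which is the convex hull of finitely many points. -/
def IsPolytope {n : ℕ} (K : ConvexBody (EuclideanSpace ℝ (Fin n))) : Prop :=
  ∃ s : Set (EuclideanSpace ℝ (Fin n)), s.Finite ∧
    (K : Set (EuclideanSpace ℝ (Fin n))) = convexHull ℝ s

/-- The local parallel set of `K` at distance `ρ` over a set `ω` of unit vectors: the points `x`
outside `K`, at distance at most `ρ` from `K`, such that the unit vector pointing from the nearest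
point `p` of `K` to `x` lies in `ω`. -/
def localParallelSet {n : ℕ} (K : ConvexBody (EuclideanSpace ℝ (Fin n)))
    (ω : Set (sphere (0 : EuclideanSpace ℝ (Fin n)) 1)) (ρ : ℝ) :
    Set (EuclideanSpace ℝ (Fin n)) :=
  {x | 0 < infDist x (K : Set (EuclideanSpace ℝ (Fin n))) ∧
    infDist x (K : Set (EuclideanSpace ℝ (Fin n))) ≤ ρ ∧
    ∃ p ∈ (K : Set (EuclideanSpace ℝ (Fin n))), ∃ u ∈ ω,
      x - p = infDist x (K : Set (EuclideanSpace ℝ (Fin n))) •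
        (u : EuclideanSpace ℝ (Fin n))}

/-- The defining property of the surface area measure `S_{n-1}(K, ·)`: for every Borel set `ω` of
the sphere, `S_{n-1}(K, ω)` is the coefficient of `ρ` in the local Steiner formula, that is, the
limit of `ρ⁻¹ vol(B_ρ(K, ω))` for `ρ → 0+`, where `B_ρ(K, ω)` is the local parallel set. -/
def IsSurfaceAreaMeasure {n : ℕ} (K : ConvexBody (EuclideanSpace ℝ (Fin n)))
    (μ : Measure (sphere (0 : EuclideanSpace ℝ (Fin n)) 1)) : Prop :=
  ∀ ω : Set (sphere (0 : EuclideanSpace ℝ (Fin n)) 1), MeasurableSet ω →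
    Tendsto (fun ρ : ℝ => volume (localParallelSet K ω ρ) / ENNReal.ofReal ρ) (𝓝[>] 0)
      (𝓝 (μ ω))

/-! ### Existence and uniqueness of the surface area measure -/

theorem isSurfaceAreaMeasure_unique {n : ℕ} {K : ConvexBody (EuclideanSpace ℝ (Fin n))}
    {μ ν : Measure (sphere (0 : EuclideanSpace ℝ (Fin n)) 1)}
    (hμ : IsSurfaceAreaMeasure K μ) (hν : IsSurfaceAreaMeasure K ν) : μ = ν :=
  Measure.ext fun ω hω => tendsto_nhds_unique (hμ ω hω) (hν ω hω)

theorem exists_nearest {n : ℕ} (K : ConvexBody (EuclideanSpace ℝ (Fin n)))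
    (x : EuclideanSpace ℝ (Fin n)) :
    ∃ p ∈ (K : Set (EuclideanSpace ℝ (Fin n))),
      infDist x (K : Set (EuclideanSpace ℝ (Fin n))) = dist x p :=
  K.isCompact.exists_infDist_eq_dist K.nonempty x

theorem nearest_iff {n : ℕ} (K : ConvexBody (EuclideanSpace ℝ (Fin n)))
    {x p : EuclideanSpace ℝ (Fin n)} (hp : p ∈ (K : Set (EuclideanSpace ℝ (Fin n)))) :
    infDist x (K : Set (EuclideanSpace ℝ (Fin n))) = dist x p ↔
      ∀ w ∈ (K : Set (EuclideanSpace ℝ (Fin n))), ⟪x - p, w - p⟫ ≤ 0 := by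
  rw [← norm_eq_iInf_iff_real_inner_le_zero K.convex hp, infDist_eq_iInf, dist_eq_norm, eq_comm]
  simp only [dist_eq_norm]

/-- The nearest-point map of `K`. -/
def nearest {n : ℕ} (K : ConvexBody (EuclideanSpace ℝ (Fin n)))
    (x : EuclideanSpace ℝ (Fin n)) : EuclideanSpace ℝ (Fin n) :=
  (exists_nearest K x).choose

theorem nearest_mem {n : ℕ} (K : ConvexBody (EuclideanSpace ℝ (Fin n)))
    (x : EuclideanSpace ℝ (Fin n)) : nearest K x ∈ (K : Set (EuclideanSpace ℝ (Fin n))) :=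
  (exists_nearest K x).choose_spec.1

theorem infDist_eq_nearest {n : ℕ} (K : ConvexBody (EuclideanSpace ℝ (Fin n)))
    (x : EuclideanSpace ℝ (Fin n)) :
    infDist x (K : Set (EuclideanSpace ℝ (Fin n))) = dist x (nearest K x) :=
  (exists_nearest K x).choose_spec.2

theorem inner_nearest_le {n : ℕ} (K : ConvexBody (EuclideanSpace ℝ (Fin n)))
    (x : EuclideanSpace ℝ (Fin n)) {w : EuclideanSpace ℝ (Fin n)}
    (hw : w ∈ (K : Set (EuclideanSpace ℝ (Fin n)))) :
    ⟪x - nearest K x, w - nearest K x⟫ ≤ 0 :=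
  (nearest_iff K (nearest_mem K x)).1 (infDist_eq_nearest K x) w hw

theorem norm_sub_le_of_variational {n : ℕ} {x y p q : EuclideanSpace ℝ (Fin n)}
    (h1 : ⟪x - p, q - p⟫ ≤ 0) (h2 : ⟪y - q, p - q⟫ ≤ 0) : ‖p - q‖ ≤ ‖x - y‖ := by
  have h3 : ⟪p - q, p - q⟫ ≤ ⟪x - y, p - q⟫ := by
    have : ⟪x - y, p - q⟫ - ⟪p - q, p - q⟫ = -⟪x - p, q - p⟫ - ⟪y - q, p - q⟫ := by
      simp only [inner_sub_left, inner_sub_right]; ring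
    linarith
  rw [real_inner_self_eq_norm_sq] at h3
  have h4 := real_inner_le_norm (x - y) (p - q)
  by_contra! h
  nlinarith [norm_nonneg (x - y), norm_nonneg (p - q)]

theorem nearest_lipschitz {n : ℕ} (K : ConvexBody (EuclideanSpace ℝ (Fin n)))
    (x y : EuclideanSpace ℝ (Fin n)) : ‖nearest K x - nearest K y‖ ≤ ‖x - y‖ :=
  norm_sub_le_of_variational (inner_nearest_le K x (nearest_mem K y))
    (inner_nearest_le K y (nearest_mem K x))

theorem nearest_eq {n : ℕ} (K : ConvexBody (EuclideanSpace ℝ (Fin n)))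
    {x p : EuclideanSpace ℝ (Fin n)} (hp : p ∈ (K : Set (EuclideanSpace ℝ (Fin n))))
    (h : ∀ w ∈ (K : Set (EuclideanSpace ℝ (Fin n))), ⟪x - p, w - p⟫ ≤ 0) : nearest K x = p := by
  have := norm_sub_le_of_variational (inner_nearest_le K x hp) (h _ (nearest_mem K x))
  simpa [sub_eq_zero] using this

theorem continuous_nearest {n : ℕ} (K : ConvexBody (EuclideanSpace ℝ (Fin n))) :
    Continuous (nearest K) :=
  (LipschitzWith.of_dist_le_mul (K := 1) fun x y => by
    simpa [dist_eq_norm] using nearest_lipschitz K x y).continuous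

/-- Along the outer normal ray through a point `x` outside `K` the nearest point is constant. -/
theorem nearest_ray {n : ℕ} (K : ConvexBody (EuclideanSpace ℝ (Fin n)))
    (x : EuclideanSpace ℝ (Fin n)) {c : ℝ} (hc : 0 ≤ c) :
    nearest K (nearest K x + c • (x - nearest K x)) = nearest K x := by
  refine nearest_eq K (nearest_mem K x) fun w hw => ?_
  rw [add_sub_cancel_left, real_inner_smul_left]
  exact mul_nonpos_of_nonneg_of_nonpos hc (inner_nearest_le K x hw)

theorem mem_localParallelSet_iff {n : ℕ} (K : ConvexBody (EuclideanSpace ℝ (Fin n)))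
    (ω : Set (sphere (0 : EuclideanSpace ℝ (Fin n)) 1)) (ρ : ℝ)
    (x : EuclideanSpace ℝ (Fin n)) :
    x ∈ localParallelSet K ω ρ ↔
      (0 < ‖x - nearest K x‖ ∧ ‖x - nearest K x‖ ≤ ρ) ∧
        ‖x - nearest K x‖⁻¹ • (x - nearest K x) ∈
          (Subtype.val '' ω : Set (EuclideanSpace ℝ (Fin n))) := by
  unfold localParallelSet
  rw [mem_ofPred_eq, infDist_eq_nearest, dist_eq_norm, and_assoc]
  refine and_congr_right fun h0 => and_congr_right fun _ => ⟨?_, ?_⟩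
  · rintro ⟨p, hp, u, hu, hxp⟩
    have hu1 : ‖(u : EuclideanSpace ℝ (Fin n))‖ = 1 := by simp
    have hd : infDist x (K : Set (EuclideanSpace ℝ (Fin n))) = dist x p := by
      rw [infDist_eq_nearest, dist_eq_norm, dist_eq_norm x p, hxp, norm_smul, hu1, norm_norm,
        mul_one]
    have hpe : nearest K x = p := nearest_eq K hp ((nearest_iff K hp).1 hd)
    refine ⟨u, hu, ?_⟩
    rw [eq_inv_smul_iff₀ h0.ne', ← hxp, hpe]
  · rintro ⟨u, hu, hux⟩
    exact ⟨nearest K x, nearest_mem K x, u, hu, by rw [hux, smul_inv_smul₀ h0.ne']⟩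

/-- An operator of norm at most one which multiplies some unit vector by `s ≥ 0` has
determinant at most `s` in absolute value. -/
theorem abs_det_le {n : ℕ} (A : EuclideanSpace ℝ (Fin n) →L[ℝ] EuclideanSpace ℝ (Fin n))
    (hA : ‖A‖ ≤ 1) {s : ℝ} (hs : 0 ≤ s) {u : EuclideanSpace ℝ (Fin n)} (hu : ‖u‖ = 1)
    (hAu : A u = s • u) : |A.det| ≤ s := by
  rcases n with _ | m
  · simp [Subsingleton.elim u 0] at hu
  have hcard : Module.finrank ℝ (EuclideanSpace ℝ (Fin (m + 1))) = Fintype.card (Fin (m + 1)) := by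
    simp
  have hor : Orthonormal ℝ (({0} : Set (Fin (m + 1))).domRestrict fun _ => u) := by
    constructor
    · intro i; exact hu
    · rintro ⟨i, hi⟩ ⟨j, hj⟩ hij
      exact absurd (Subtype.ext (hi.trans hj.symm)) hij
  obtain ⟨b, hb⟩ := hor.exists_orthonormalBasis_extension_of_card_eq hcard
  have hb0 : b 0 = u := hb 0 rfl
  have : Fact (Module.finrank ℝ (EuclideanSpace ℝ (Fin (m + 1))) = m + 1) := ⟨by simp⟩
  have h := b.toBasis.orientation.abs_volumeForm_apply_le (fun i => A (b i))
  rw [Orientation.volumeForm_robust _ b rfl] at h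
  have hdet : b.toBasis.det (fun i => A (b i)) = A.det := by
    have := b.toBasis.det_comp (A : EuclideanSpace ℝ (Fin (m + 1)) →ₗ[ℝ] _) b
    rw [← b.coe_toBasis, b.toBasis.det_self, mul_one] at this
    rw [ContinuousLinearMap.det, ← this, b.coe_toBasis]
    rfl
  rw [hdet, Fin.prod_univ_succ, hb0, hAu, norm_smul, hu, mul_one, Real.norm_of_nonneg hs] at h
  refine h.trans (mul_le_of_le_one_right hs (Finset.prod_le_one (fun _ _ => norm_nonneg _) ?_))
  intro i _
  refine (A.le_opNorm _).trans ?_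
  rw [b.norm_eq_one, mul_one]
  exact hA

/-- The contraction towards `K` by the factor `s`. -/
def contract {n : ℕ} (K : ConvexBody (EuclideanSpace ℝ (Fin n))) (s : ℝ)
    (x : EuclideanSpace ℝ (Fin n)) : EuclideanSpace ℝ (Fin n) :=
  nearest K x + s • (x - nearest K x)

theorem contract_lipschitz {n : ℕ} (K : ConvexBody (EuclideanSpace ℝ (Fin n))) {s : ℝ}
    (hs : 0 ≤ s) (hs1 : s ≤ 1) : LipschitzWith 1 (contract K s) := by
  refine LipschitzWith.of_dist_le_mul fun x y => ?_
  have h : contract K s x - contract K s y =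
      s • (x - y) + (1 - s) • (nearest K x - nearest K y) := by
    simp only [contract]; module
  rw [dist_eq_norm, dist_eq_norm, h, NNReal.coe_one, one_mul]
  refine (norm_add_le _ _).trans ?_
  rw [norm_smul, norm_smul, Real.norm_of_nonneg hs, Real.norm_of_nonneg (sub_nonneg.2 hs1)]
  nlinarith [nearest_lipschitz K x y]

theorem volume_image_eq_zero_of_lipschitz {n : ℕ}
    {g : EuclideanSpace ℝ (Fin n) → EuclideanSpace ℝ (Fin n)} (hg : LipschitzWith 1 g)
    {s : Set (EuclideanSpace ℝ (Fin n))} (hs : volume s = 0) : volume (g '' s) = 0 := by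
  have hac : (μH[Module.finrank ℝ (EuclideanSpace ℝ (Fin n))] :
      Measure (EuclideanSpace ℝ (Fin n))) ≪ volume :=
    Measure.absolutelyContinuous_isAddHaarMeasure _ _
  have hac' : (volume : Measure (EuclideanSpace ℝ (Fin n))) ≪
      μH[Module.finrank ℝ (EuclideanSpace ℝ (Fin n))] :=
    Measure.absolutelyContinuous_isAddHaarMeasure _ _
  refine hac' (le_antisymm ?_ bot_le)
  refine (hg.hausdorffMeasure_image_le (Nat.cast_nonneg _) s).trans ?_
  rw [hac hs, mul_zero]

theorem fderiv_contract_apply {n : ℕ} (K : ConvexBody (EuclideanSpace ℝ (Fin n))) {s : ℝ}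
    {x : EuclideanSpace ℝ (Fin n)} (h : DifferentiableAt ℝ (contract K s) x) :
    fderiv ℝ (contract K s) x (x - nearest K x) = s • (x - nearest K x) := by
  have hl : HasDerivAt (fun t : ℝ => x + t • (x - nearest K x)) (x - nearest K x) 0 := by
    simpa using ((hasDerivAt_id (0 : ℝ)).smul_const (x - nearest K x)).const_add x
  have h0 : HasFDerivAt (contract K s) (fderiv ℝ (contract K s) x)
      (x + (0 : ℝ) • (x - nearest K x)) := by
    simpa using h.hasFDerivAt
  have h1 := h0.comp_hasDerivAt (0 : ℝ) hl
  have h2 : HasDerivAt (fun t : ℝ => nearest K x + (s * (1 + t)) • (x - nearest K x))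
      (s • (x - nearest K x)) 0 := by
    have : HasDerivAt (fun t : ℝ => s * (1 + t)) s 0 := by
      simpa using ((hasDerivAt_id (0 : ℝ)).const_add 1).const_mul s
    exact (this.smul_const (x - nearest K x)).const_add (nearest K x)
  refine h1.unique (h2.congr_of_eventuallyEq ?_)
  filter_upwards [lt_mem_nhds (show (-1 : ℝ) < 0 by norm_num)] with t ht
  have hx : x + t • (x - nearest K x) = nearest K x + (1 + t) • (x - nearest K x) := by module
  have hn := nearest_ray K x (c := 1 + t) (by linarith)
  simp only [Function.comp_apply, contract]
  rw [hx, hn]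
  module

theorem measurableSet_localParallelSet {n : ℕ} (K : ConvexBody (EuclideanSpace ℝ (Fin n)))
    {ω : Set (sphere (0 : EuclideanSpace ℝ (Fin n)) 1)} (hω : MeasurableSet ω) (ρ : ℝ) :
    MeasurableSet (localParallelSet K ω ρ) := by
  have hp := (continuous_nearest K).measurable
  have hm : Measurable fun x => x - nearest K x := measurable_id.sub hp
  have himg : MeasurableSet (Subtype.val '' ω : Set (EuclideanSpace ℝ (Fin n))) :=
    isClosed_sphere.measurableSet.subtype_image hω
  have : localParallelSet K ω ρ = (fun x => ‖x - nearest K x‖) ⁻¹' Ioc 0 ρ ∩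
      (fun x => ‖x - nearest K x‖⁻¹ • (x - nearest K x)) ⁻¹' (Subtype.val '' ω) := by
    ext x; exact mem_localParallelSet_iff K ω ρ x
  rw [this]
  exact (hm.norm measurableSet_Ioc).inter ((hm.norm.inv.smul hm) himg)

theorem volume_contract_image_le {n : ℕ} (K : ConvexBody (EuclideanSpace ℝ (Fin n))) {s : ℝ}
    (hs : 0 ≤ s) (hs1 : s ≤ 1) {A : Set (EuclideanSpace ℝ (Fin n))} (hA : MeasurableSet A)
    (hAK : ∀ x ∈ A, 0 < ‖x - nearest K x‖) :
    volume (contract K s '' A) ≤ ENNReal.ofReal s * volume A := by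
  have hL := contract_lipschitz K hs hs1
  set D := {x | DifferentiableAt ℝ (contract K s) x} with hD
  have hDm : MeasurableSet D := measurableSet_of_differentiableAt ℝ _
  have hDc : volume (A \ D) = 0 :=
    measure_mono_null (fun x hx => hx.2) (ae_iff.1 (hL.ae_differentiableAt (μ := volume)))
  have h1 : volume (contract K s '' (A ∩ D)) ≤ ENNReal.ofReal s * volume A := by
    refine (addHaar_image_le_lintegral_abs_det_fderiv volume (hA.inter hDm)
      (fun x hx => (DifferentiableAt.hasFDerivAt hx.2).hasFDerivWithinAt)).trans ?_
    calc _ ≤ ∫⁻ _ in A ∩ D, ENNReal.ofReal s := by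
          refine setLIntegral_mono measurable_const fun x hx => ENNReal.ofReal_le_ofReal ?_
          have h0 := hAK x hx.1
          refine abs_det_le _ (by simpa using norm_fderiv_le_of_lipschitz ℝ hL) hs
            (u := ‖x - nearest K x‖⁻¹ • (x - nearest K x)) ?_ ?_
          · rw [norm_smul, norm_inv, norm_norm, inv_mul_cancel₀ h0.ne']
          · rw [map_smul, fderiv_contract_apply K hx.2, smul_comm]
      _ = ENNReal.ofReal s * volume (A ∩ D) := by simp
      _ ≤ _ := by gcongr; exact inter_subset_left
  calc volume (contract K s '' A)
      = volume (contract K s '' (A ∩ D) ∪ contract K s '' (A \ D)) := by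
        rw [← image_union, inter_union_sdiff]
    _ ≤ _ := (measure_union_le _ _).trans
        (by rw [volume_image_eq_zero_of_lipschitz hL hDc, add_zero]; exact h1)

/-- The normalized volume of local parallel sets is monotone in the distance. -/
theorem localParallel_mono {n : ℕ} (K : ConvexBody (EuclideanSpace ℝ (Fin n)))
    {ω : Set (sphere (0 : EuclideanSpace ℝ (Fin n)) 1)} (hω : MeasurableSet ω) {r ρ : ℝ}
    (hr : 0 < r) (hrρ : r ≤ ρ) :
    volume (localParallelSet K ω r) / ENNReal.ofReal r ≤
      volume (localParallelSet K ω ρ) / ENNReal.ofReal ρ := by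
  have hρ : 0 < ρ := hr.trans_le hrρ
  have hs : 0 < r / ρ := div_pos hr hρ
  have hs1 : r / ρ ≤ 1 := (div_le_one hρ).2 hrρ
  have hsub : localParallelSet K ω r ⊆ contract K (r / ρ) '' localParallelSet K ω ρ := by
    intro y hy
    rw [mem_localParallelSet_iff] at hy
    obtain ⟨⟨hy0, hyr⟩, hyω⟩ := hy
    have hc : 0 < ρ / r := div_pos hρ hr
    have hn := nearest_ray K y hc.le
    refine ⟨nearest K y + (ρ / r) • (y - nearest K y), ?_, ?_⟩
    · rw [mem_localParallelSet_iff, hn, add_sub_cancel_left, norm_smul,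
        Real.norm_of_nonneg hc.le]
      refine ⟨⟨by positivity, ?_⟩, ?_⟩
      · rw [div_mul_eq_mul_div, div_le_iff₀ hr]; gcongr
      · convert hyω using 1
        rw [smul_smul]
        congr 1
        field_simp
    · rw [contract, hn, add_sub_cancel_left, smul_smul,
        show r / ρ * (ρ / r) = 1 by field_simp, one_smul, add_sub_cancel]
  have h := (measure_mono hsub).trans (volume_contract_image_le K hs.le hs1
    (measurableSet_localParallelSet K hω ρ)
    fun x hx => ((mem_localParallelSet_iff K ω ρ x).1 hx).1.1)
  rw [ENNReal.ofReal_div_of_pos hρ] at h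
  rw [ENNReal.div_le_iff (by simpa using hr) ENNReal.ofReal_ne_top]
  refine h.trans (le_of_eq ?_)
  simp only [div_eq_mul_inv]; ring

theorem volume_localParallelSet_iUnion {n : ℕ} (K : ConvexBody (EuclideanSpace ℝ (Fin n)))
    {ω : ℕ → Set (sphere (0 : EuclideanSpace ℝ (Fin n)) 1)} (hω : ∀ i, MeasurableSet (ω i))
    (hd : Pairwise (Function.onFun Disjoint ω)) (ρ : ℝ) :
    volume (localParallelSet K (⋃ i, ω i) ρ) = ∑' i, volume (localParallelSet K (ω i) ρ) := by
  rw [← measure_iUnion _ fun i => measurableSet_localParallelSet K (hω i) ρ]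
  · congr 1
    ext x
    simp only [mem_iUnion, mem_localParallelSet_iff, image_iUnion, exists_and_left]
  · intro i j hij
    refine Set.disjoint_left.2 fun x hi hj => ?_
    obtain ⟨u, hu, hux⟩ := ((mem_localParallelSet_iff K _ ρ x).1 hi).2
    obtain ⟨v, hv, hvx⟩ := ((mem_localParallelSet_iff K _ ρ x).1 hj).2
    have huv : u = v := Subtype.ext (hux.trans hvx.symm)
    exact Set.disjoint_left.1 (hd hij) hu (huv ▸ hv)

theorem volume_localParallelSet_lt_top {n : ℕ} (K : ConvexBody (EuclideanSpace ℝ (Fin n)))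
    (ω : Set (sphere (0 : EuclideanSpace ℝ (Fin n)) 1)) (ρ : ℝ) :
    volume (localParallelSet K ω ρ) < ∞ := by
  refine lt_of_le_of_lt (measure_mono fun x hx => ?_)
    (K.isCompact.isBounded.cthickening (δ := ρ)).measure_lt_top
  rw [cthickening, mem_ofPred_eq, ← ENNReal.ofReal_toReal
    (infEDist_ne_top (s := (K : Set (EuclideanSpace ℝ (Fin n)))) (x := x) K.nonempty)]
  exact ENNReal.ofReal_le_ofReal hx.2.1

/-- Every convex body has a surface area measure. -/
theorem exists_isSurfaceAreaMeasure {n : ℕ} (K : ConvexBody (EuclideanSpace ℝ (Fin n))) :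
    ∃ μ : Measure (sphere (0 : EuclideanSpace ℝ (Fin n)) 1), IsSurfaceAreaMeasure K μ := by
  set q : ℝ → Set (sphere (0 : EuclideanSpace ℝ (Fin n)) 1) → ℝ≥0∞ :=
    fun ρ ω => volume (localParallelSet K ω ρ) / ENNReal.ofReal ρ with hq
  set r : ℕ → ℝ := fun k => 1 / ((k : ℝ) + 1) with hr
  have hr0 : ∀ k, 0 < r k := fun k => Nat.one_div_pos_of_nat
  have hra : Antitone r := fun _ _ h => Nat.one_div_le_one_div h
  have hqa : ∀ ω, MeasurableSet ω → Antitone fun k => q (r k) ω := fun ω hω i j hij =>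
    localParallel_mono K hω (hr0 j) (hra hij)
  have hfin : ∀ ω k, q (r k) ω ≠ ∞ := fun ω k =>
    (ENNReal.div_lt_top (volume_localParallelSet_lt_top K ω _).ne (by simpa using hr0 k)).ne
  have hU : ∀ (ω : ℕ → Set (sphere (0 : EuclideanSpace ℝ (Fin n)) 1)),
      (∀ i, MeasurableSet (ω i)) → Pairwise (Function.onFun Disjoint ω) → ∀ ρ,
      q ρ (⋃ i, ω i) = ∑' i, q ρ (ω i) := fun ω hω hd ρ => by
    simp only [hq, volume_localParallelSet_iUnion K hω hd, div_eq_mul_inv, ENNReal.tsum_mul_right]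
  refine ⟨Measure.ofMeasurable (fun ω _ => ⨅ k, q (r k) ω) ?_ ?_, fun ω hω => ?_⟩
  · have h0 : localParallelSet K ∅ (r 0) = ∅ := by
      ext x; simp [mem_localParallelSet_iff]
    refine le_antisymm ((iInf_le _ 0).trans ?_) bot_le
    simp [hq, h0]
  · intro ω hω hd
    simp only [hU ω hω hd]
    have h := lintegral_iInf (μ := Measure.count) (f := fun k (i : ℕ) => q (r k) (ω i))
      (fun _ => measurable_of_countable _) (fun i j hij l => hqa (ω l) (hω l) hij) (by
        rw [lintegral_count, ← hU ω hω hd]; exact hfin _ 0)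
    simp only [lintegral_count] at h
    exact h.symm
  · rw [Measure.ofMeasurable_apply ω hω]
    refine tendsto_order.2 ⟨fun a ha => ?_, fun b hb => ?_⟩
    · filter_upwards [self_mem_nhdsWithin] with ρ hρ
      obtain ⟨k, hk⟩ := exists_nat_one_div_lt (show (0 : ℝ) < ρ from hρ)
      exact ha.trans_le ((iInf_le _ k).trans (localParallel_mono K hω (hr0 k) hk.le))
    · obtain ⟨k, hk⟩ := iInf_lt_iff.1 hb
      filter_upwards [Ioc_mem_nhdsGT (hr0 k)] with ρ hρ
      exact (localParallel_mono K hω hρ.1 hρ.2).trans_lt hk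

/-- The surface area measure `S_{n-1}(K, ·)` of a convex body `K`, a Borel measure on the unit
sphere. -/
def surfaceAreaMeasure {n : ℕ} (K : ConvexBody (EuclideanSpace ℝ (Fin n))) :
    Measure (sphere (0 : EuclideanSpace ℝ (Fin n)) 1) :=
  (exists_isSurfaceAreaMeasure K).choose

theorem isSurfaceAreaMeasure_surfaceAreaMeasure {n : ℕ}
    (K : ConvexBody (EuclideanSpace ℝ (Fin n))) :
    IsSurfaceAreaMeasure K (surfaceAreaMeasure K) :=
  (exists_isSurfaceAreaMeasure K).choose_spec

end SurfaceArea

end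

/-!
The surface area measures of polytopes already determine `f` up to what the centroid relation
leaves free, so `f` is linear; and linear functions integrate to zero against every surface area
measure.

*Centroid relation.* For every convex body `K` and every vector `a`, the integral of
`u ↦ ⟪a, u⟫` against the surface area measure of `K` vanishes
(`SurfaceArea.integral_inner_surfaceAreaMeasure`). The outer normals in the collar
`0 < d(x, K) ≤ ρ` are, up to sign, the gradient of the compactly supported Lipschitz function
`max (ρ - d(x, K)) 0`, whose integral is zero by Rademacher's theorem and integration by parts.
The distributions of these normals, divided by `ρ`, dominate the surface area measure, and their
total masses converge to its total mass as `ρ` tends to zero.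

*Circumscribed polytopes.* Let `N` be a finite nonempty set of unit vectors such that the
intersection of the half-spaces `⟪v, x⟫ ≤ 1` for `v ∈ N` is bounded. It is a polytope by the
Krein–Milman theorem, its surface area measure vanishes outside `N`
(`SurfaceArea.surfaceAreaMeasure_compl_eq_zero`), and it charges every point of `N`
(`SurfaceArea.surfaceAreaMeasure_singleton_pos`). Hence, if a function has zero integral against
the surface area measure of every polytope and vanishes at all points of `N` but one, it also
vanishes at the last one.

*Linearity.* Subtracting a linear function from `f`, which does not affect the integrals by the
centroid relation, gives a function `g` that vanishes at the standard basis vectors. Apply the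
previous step to the simplex whose normals are these and `-(1, …, 1) / √n`: then `g` vanishes at
all normals of this simplex. Truncating the simplex by the half-space with an arbitrary unit
normal `u` shows that `g u = 0`.
-/

namespace SurfaceArea

variable {n : ℕ}

/-! ### The centroid of the surface area measure -/

/-- The outer unit normal of the parallel body of `K` through `x`, for `x` outside `K`;
the value is `0` on `K`. -/
noncomputable def outerNormal (K : ConvexBody (EuclideanSpace ℝ (Fin n)))
    (x : EuclideanSpace ℝ (Fin n)) : EuclideanSpace ℝ (Fin n) :=
  ‖x - nearest K x‖⁻¹ • (x - nearest K x)

theorem norm_outerNormal {K : ConvexBody (EuclideanSpace ℝ (Fin n))}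
    {x : EuclideanSpace ℝ (Fin n)} (hx : 0 < ‖x - nearest K x‖) : ‖outerNormal K x‖ = 1 := by
  rw [outerNormal, norm_smul, norm_inv, norm_norm, inv_mul_cancel₀ hx.ne']

theorem measurable_outerNormal (K : ConvexBody (EuclideanSpace ℝ (Fin n))) :
    Measurable (outerNormal K) := by
  have hm : Measurable fun x => x - nearest K x :=
    measurable_id.sub (continuous_nearest K).measurable
  exact hm.norm.inv.smul hm

theorem mem_localParallelSet_preimage {K : ConvexBody (EuclideanSpace ℝ (Fin n))}
    {A : Set (EuclideanSpace ℝ (Fin n))} {ρ : ℝ} {x : EuclideanSpace ℝ (Fin n)} :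
    x ∈ localParallelSet K (Subtype.val ⁻¹' A) ρ ↔
      (0 < ‖x - nearest K x‖ ∧ ‖x - nearest K x‖ ≤ ρ) ∧ outerNormal K x ∈ A := by
  rw [mem_localParallelSet_iff]
  refine and_congr_right fun h => ?_
  rw [Subtype.image_preimage_coe]
  exact ⟨fun h => h.2, fun h' => ⟨by simpa [outerNormal] using norm_outerNormal h.1, h'⟩⟩

theorem mem_localParallelSet_univ {K : ConvexBody (EuclideanSpace ℝ (Fin n))}
    {ρ : ℝ} {x : EuclideanSpace ℝ (Fin n)} :
    x ∈ localParallelSet K univ ρ ↔ 0 < ‖x - nearest K x‖ ∧ ‖x - nearest K x‖ ≤ ρ := by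
  rw [← preimage_univ (f := Subtype.val), mem_localParallelSet_preimage]; simp

/-- The derivative of the truncated distance function `max (ρ - d(x, K)) 0` at a point of
differentiability is minus the outer normal in the collar `0 < d(x, K) ≤ ρ`: the function
`max (ρ - d(y, K)) 0 + ‖y - p‖` is minimal at `x`, where `p` is the point of `K` nearest
to `x`. -/
theorem fderiv_max_sub_infDist_of_mem {K : ConvexBody (EuclideanSpace ℝ (Fin n))} {ρ : ℝ}
    {x : EuclideanSpace ℝ (Fin n)} (hx : x ∈ localParallelSet K univ ρ)
    (hd : DifferentiableAt ℝ (fun y => max (ρ - infDist y (K : Set (EuclideanSpace ℝ (Fin n)))) 0)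
      x) (v : EuclideanSpace ℝ (Fin n)) :
    fderiv ℝ (fun y => max (ρ - infDist y (K : Set (EuclideanSpace ℝ (Fin n)))) 0) x v =
      -⟪outerNormal K x, v⟫ := by
  rw [mem_localParallelSet_univ] at hx
  set p := nearest K x with hp
  have hne : x - p ≠ 0 := norm_pos_iff.1 hx.1
  have h1 : HasFDerivAt (fun y => ‖y - p‖) (fderiv ℝ (fun y => ‖y - p‖) x) x :=
    (((differentiableAt_id).sub_const p).norm ℝ hne).hasFDerivAt
  have hmin : IsLocalMin (fun y => max (ρ - infDist y (K : Set (EuclideanSpace ℝ (Fin n)))) 0 +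
      ‖y - p‖) x := by
    refine Filter.Eventually.of_forall fun y => ?_
    have hy : infDist y (K : Set (EuclideanSpace ℝ (Fin n))) ≤ ‖y - p‖ := by
      rw [← dist_eq_norm]; exact infDist_le_dist_of_mem (nearest_mem K x)
    have hxd : infDist x (K : Set (EuclideanSpace ℝ (Fin n))) = ‖x - p‖ := by
      rw [infDist_eq_nearest, dist_eq_norm]
    have : max (ρ - infDist x (K : Set (EuclideanSpace ℝ (Fin n)))) 0 = ρ - ‖x - p‖ := by
      rw [hxd]; exact max_eq_left (by linarith [hx.2])
    dsimp only
    rw [this]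
    linarith [le_max_left (ρ - infDist y (K : Set (EuclideanSpace ℝ (Fin n)))) 0]
  have h2 := hmin.hasFDerivAt_eq_zero (hd.hasFDerivAt.add h1)
  have h3 : fderiv ℝ (fun y => ‖y - p‖) x v = ⟪outerNormal K x, v⟫ := by
    have hsq : HasFDerivAt (fun y => ‖y - p‖ ^ 2) _ x := ((hasFDerivAt_id x).sub_const p).norm_sq
    have hsq' := h1.pow 2
    have := congrArg (fun L => L v) (hsq'.unique hsq)
    simp only [outerNormal, ← hp, real_inner_smul_left]
    simp [← inner_sub_left] at this
    have h0 : ‖x - p‖ ≠ 0 := norm_ne_zero_iff.2 hne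
    field_simp
    linarith
  have h4 := congrArg (fun L => L v) h2
  simp only [add_apply, zero_apply, h3] at h4
  linarith

/-- Outside the collar `0 < d(x, K) ≤ ρ` the truncated distance function takes its maximum `ρ`
or its minimum `0`, so its derivative vanishes. -/
theorem fderiv_max_sub_infDist_of_notMem {K : ConvexBody (EuclideanSpace ℝ (Fin n))} {ρ : ℝ}
    {x : EuclideanSpace ℝ (Fin n)} (hx : x ∉ localParallelSet K univ ρ) :
    fderiv ℝ (fun y => max (ρ - infDist y (K : Set (EuclideanSpace ℝ (Fin n)))) 0) x = 0 := by
  rw [mem_localParallelSet_univ, not_and_or, not_lt, not_le] at hx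
  have hxd : infDist x (K : Set (EuclideanSpace ℝ (Fin n))) = ‖x - nearest K x‖ := by
    rw [infDist_eq_nearest, dist_eq_norm]
  rw [← hxd] at hx
  rcases hx with hx | hx
  · refine IsLocalMax.fderiv_eq_zero (Filter.Eventually.of_forall fun y => ?_)
    have hy := infDist_nonneg (x := y) (s := (K : Set (EuclideanSpace ℝ (Fin n))))
    dsimp only
    exact max_le_max_right 0 (by linarith)
  · refine IsLocalMin.fderiv_eq_zero (Filter.Eventually.of_forall fun y => ?_)
    dsimp only
    rw [max_eq_right (by linarith : ρ - infDist x (K : Set (EuclideanSpace ℝ (Fin n))) ≤ 0)]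
    exact le_max_right _ _

/-- The outer normals of a collar of `K` average to zero: up to sign they are the gradient of a
Lipschitz function with compact support. -/
theorem setIntegral_inner_outerNormal (K : ConvexBody (EuclideanSpace ℝ (Fin n)))
    (a : EuclideanSpace ℝ (Fin n)) (ρ : ℝ) :
    ∫ x in localParallelSet K univ ρ, ⟪a, outerNormal K x⟫ = 0 := by
  set g : EuclideanSpace ℝ (Fin n) → ℝ :=
    fun y => max (ρ - infDist y (K : Set (EuclideanSpace ℝ (Fin n)))) 0 with hg
  have hgl : LipschitzWith 1 g := by
    refine LipschitzWith.of_dist_le_mul fun x y => ?_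
    have h := (lipschitz_infDist_pt (K : Set (EuclideanSpace ℝ (Fin n)))).dist_le_mul x y
    refine le_trans ?_ h
    rw [Real.dist_eq, Real.dist_eq]
    refine (abs_max_sub_max_le_abs _ _ _).trans (le_of_eq ?_)
    rw [← abs_neg]; congr 1; ring
  have hgs : HasCompactSupport g := by
    refine HasCompactSupport.intro (K.isCompact.cthickening (r := ρ)) fun x hx => ?_
    refine max_eq_right (sub_nonpos.2 (le_of_not_ge fun h => hx ?_))
    exact mem_cthickening_of_dist_le x (nearest K x) ρ _ (nearest_mem K x)
      (infDist_eq_nearest K x ▸ h)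
  have h := (LipschitzWith.const (1 : ℝ)).integral_lineDeriv_mul_eq (μ := volume) hgl hgs a
  have hae : ∀ᵐ x, lineDeriv ℝ g x (-a) =
      (localParallelSet K univ ρ).indicator (fun x => ⟪a, outerNormal K x⟫) x := by
    filter_upwards [hgl.ae_differentiableAt (μ := volume)] with x hx
    rw [hx.lineDeriv_eq_fderiv]
    by_cases hm : x ∈ localParallelSet K univ ρ
    · rw [indicator_of_mem hm, fderiv_max_sub_infDist_of_mem hm hx, inner_neg_right, neg_neg,
        real_inner_comm]
    · rw [indicator_of_notMem hm, fderiv_max_sub_infDist_of_notMem hm, zero_apply]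
  rw [← integral_indicator (measurableSet_localParallelSet K MeasurableSet.univ ρ),
    ← integral_congr_ae hae]
  simpa [lineDeriv] using h.symm

instance isFiniteMeasure_surfaceAreaMeasure (K : ConvexBody (EuclideanSpace ℝ (Fin n))) :
    IsFiniteMeasure (surfaceAreaMeasure K) := by
  refine ⟨lt_of_le_of_lt ?_ (ENNReal.div_lt_top (volume_localParallelSet_lt_top K univ 1).ne
    (by simp : ENNReal.ofReal 1 ≠ 0))⟩
  refine le_of_tendsto (isSurfaceAreaMeasure_surfaceAreaMeasure K univ MeasurableSet.univ) ?_
  filter_upwards [Ioc_mem_nhdsGT one_pos] with ρ hρ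
  exact localParallel_mono K MeasurableSet.univ hρ.1 hρ.2

theorem surfaceAreaMeasure_le (K : ConvexBody (EuclideanSpace ℝ (Fin n)))
    {ω : Set (sphere (0 : EuclideanSpace ℝ (Fin n)) 1)} (hω : MeasurableSet ω) {ρ : ℝ}
    (hρ : 0 < ρ) :
    surfaceAreaMeasure K ω ≤ volume (localParallelSet K ω ρ) / ENNReal.ofReal ρ := by
  refine le_of_tendsto (isSurfaceAreaMeasure_surfaceAreaMeasure K ω hω) ?_
  filter_upwards [Ioc_mem_nhdsGT hρ] with r hr
  exact localParallel_mono K hω hr.1 hr.2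

/-- The distribution of the outer normals of the collar of width `ρ`, divided by `ρ`. As `ρ` tends
to zero, it decreases to the surface area measure. -/
noncomputable def collarMeasure (K : ConvexBody (EuclideanSpace ℝ (Fin n))) (ρ : ℝ) :
    Measure (EuclideanSpace ℝ (Fin n)) :=
  (ENNReal.ofReal ρ)⁻¹ • (volume.restrict (localParallelSet K univ ρ)).map (outerNormal K)

theorem collarMeasure_apply (K : ConvexBody (EuclideanSpace ℝ (Fin n))) (ρ : ℝ)
    {A : Set (EuclideanSpace ℝ (Fin n))} (hA : MeasurableSet A) :
    collarMeasure K ρ A =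
      volume (localParallelSet K (Subtype.val ⁻¹' A) ρ) / ENNReal.ofReal ρ := by
  rw [collarMeasure, Measure.smul_apply, Measure.map_apply (measurable_outerNormal K) hA,
    Measure.restrict_apply (measurable_outerNormal K hA), smul_eq_mul, div_eq_mul_inv, mul_comm]
  congr 2
  ext x
  rw [mem_localParallelSet_preimage, mem_inter_iff, mem_localParallelSet_univ, and_comm]
  rfl

theorem isFiniteMeasure_collarMeasure (K : ConvexBody (EuclideanSpace ℝ (Fin n))) {ρ : ℝ}
    (hρ : 0 < ρ) : IsFiniteMeasure (collarMeasure K ρ) := by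
  refine ⟨?_⟩
  rw [collarMeasure_apply K ρ MeasurableSet.univ]
  exact ENNReal.div_lt_top (volume_localParallelSet_lt_top K _ ρ).ne (by simpa using hρ)

theorem map_surfaceAreaMeasure_le_collarMeasure (K : ConvexBody (EuclideanSpace ℝ (Fin n)))
    {ρ : ℝ} (hρ : 0 < ρ) : (surfaceAreaMeasure K).map Subtype.val ≤ collarMeasure K ρ := by
  refine Measure.le_iff.2 fun A hA => ?_
  rw [Measure.map_apply measurable_subtype_coe hA, collarMeasure_apply K ρ hA]
  exact surfaceAreaMeasure_le K (measurable_subtype_coe hA) hρ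

theorem ae_norm_eq_one_collarMeasure (K : ConvexBody (EuclideanSpace ℝ (Fin n))) (ρ : ℝ) :
    ∀ᵐ u ∂collarMeasure K ρ, ‖u‖ = 1 := by
  have hm : MeasurableSet {u : EuclideanSpace ℝ (Fin n) | ‖u‖ = 1} :=
    measurableSet_eq_fun measurable_norm measurable_const
  refine Measure.ae_smul_measure ?_ _
  rw [ae_map_iff (measurable_outerNormal K).aemeasurable hm,
    ae_restrict_iff' (measurableSet_localParallelSet K MeasurableSet.univ ρ)]
  exact Filter.Eventually.of_forall fun x hx =>
    norm_outerNormal (mem_localParallelSet_univ.1 hx).1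

theorem integral_inner_collarMeasure (K : ConvexBody (EuclideanSpace ℝ (Fin n)))
    (a : EuclideanSpace ℝ (Fin n)) (ρ : ℝ) :
    ∫ u, ⟪a, u⟫ ∂collarMeasure K ρ = 0 := by
  rw [collarMeasure, integral_smul_measure,
    integral_map (measurable_outerNormal K).aemeasurable (by fun_prop),
    setIntegral_inner_outerNormal K a ρ, smul_zero]

/-- The function `‖a‖ + ⟪a, u⟫` is nonnegative on the sphere, so its integral only grows when the
surface area measure is replaced by the larger collar measure; there it equals `‖a‖` times the total
mass, which tends to that of the surface area measure. -/
theorem integral_inner_surfaceAreaMeasure_le (K : ConvexBody (EuclideanSpace ℝ (Fin n)))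
    (a : EuclideanSpace ℝ (Fin n)) :
    ∫ u, ⟪a, (u : EuclideanSpace ℝ (Fin n))⟫ ∂surfaceAreaMeasure K ≤ 0 := by
  set S := (surfaceAreaMeasure K).map (Subtype.val : _ → EuclideanSpace ℝ (Fin n)) with hS
  have hI : ∫ u, ⟪a, (u : EuclideanSpace ℝ (Fin n))⟫ ∂surfaceAreaMeasure K =
      ∫ u, ⟪a, u⟫ ∂S := by
    rw [hS, integral_map measurable_subtype_coe.aemeasurable (by fun_prop)]
  rw [hI]
  have hbound : ∀ ρ : ℝ, 0 < ρ →
      ∫ u, ⟪a, u⟫ ∂S ≤ ‖a‖ * ((collarMeasure K ρ).real univ - S.real univ) := by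
    intro ρ hρ
    have := isFiniteMeasure_collarMeasure K hρ
    have hle := map_surfaceAreaMeasure_le_collarMeasure K hρ
    have hab : ∀ᵐ u ∂collarMeasure K ρ, ‖⟪a, u⟫‖ ≤ ‖a‖ := by
      filter_upwards [ae_norm_eq_one_collarMeasure K ρ] with u hu
      simpa [hu] using norm_inner_le_norm (𝕜 := ℝ) a u
    have hint : Integrable (fun u => ⟪a, u⟫) (collarMeasure K ρ) :=
      Integrable.of_bound (by fun_prop) ‖a‖ hab
    have hintS : Integrable (fun u => ⟪a, u⟫) S := hint.mono_measure hle
    have h := integral_mono_measure hle (f := fun u => ‖a‖ + ⟪a, u⟫)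
      (by filter_upwards [hab] with u hu; simp at hu ⊢; linarith [neg_le_of_abs_le hu])
      ((integrable_const _).add hint)
    rw [integral_add (integrable_const _) hint, integral_add (integrable_const _) hintS,
      integral_inner_collarMeasure K a ρ, integral_const, integral_const, smul_eq_mul,
      smul_eq_mul] at h
    linarith
  have hlim : Tendsto (fun ρ : ℝ => ‖a‖ * ((collarMeasure K ρ).real univ - S.real univ)) (𝓝[>] 0)
      (𝓝 (‖a‖ * (S.real univ - S.real univ))) := by
    refine (Tendsto.sub_const ?_ _).const_mul _
    refine (ENNReal.tendsto_toReal (measure_ne_top S univ)).comp ?_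
    have h := isSurfaceAreaMeasure_surfaceAreaMeasure K univ MeasurableSet.univ
    rw [hS, Measure.map_apply measurable_subtype_coe MeasurableSet.univ]
    simp only [collarMeasure_apply K _ MeasurableSet.univ, preimage_univ]
    exact h
  refine (ge_of_tendsto hlim ?_).trans_eq (by simp)
  filter_upwards [self_mem_nhdsWithin] with ρ hρ
  exact hbound ρ hρ

/-- The surface area measure of every convex body has its centroid at the origin. -/
theorem integral_inner_surfaceAreaMeasure (K : ConvexBody (EuclideanSpace ℝ (Fin n)))
    (a : EuclideanSpace ℝ (Fin n)) :
    ∫ u, ⟪a, (u : EuclideanSpace ℝ (Fin n))⟫ ∂surfaceAreaMeasure K = 0 := by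
  refine le_antisymm (integral_inner_surfaceAreaMeasure_le K a) ?_
  have h := integral_inner_surfaceAreaMeasure_le K (-a)
  simp only [inner_neg_left, integral_neg] at h
  linarith

/-! ### Polyhedra circumscribed about the unit ball -/

/-- The intersection of the half-spaces that contain the unit ball and are bounded by its tangent
hyperplanes at the points of the finite set `N`. -/
def circumscribed (N : Finset (sphere (0 : EuclideanSpace ℝ (Fin n)) 1)) :
    Set (EuclideanSpace ℝ (Fin n)) :=
  {x | ∀ v ∈ N, ⟪(v : EuclideanSpace ℝ (Fin n)), x⟫ ≤ 1}

theorem convex_circumscribed (N : Finset (sphere (0 : EuclideanSpace ℝ (Fin n)) 1)) :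
    Convex ℝ (circumscribed N) := by
  have : circumscribed N =
      ⋂ v ∈ N, {x | ⟪(v : EuclideanSpace ℝ (Fin n)), x⟫ ≤ 1} := by
    ext x; simp [circumscribed]
  rw [this]
  exact convex_iInter₂ fun v _ => convex_halfSpace_le (innerₗ _ (v : EuclideanSpace ℝ (Fin n))).isLinear 1

theorem isClosed_circumscribed (N : Finset (sphere (0 : EuclideanSpace ℝ (Fin n)) 1)) :
    IsClosed (circumscribed N) := by
  have : circumscribed N =
      ⋂ v ∈ N, {x | ⟪(v : EuclideanSpace ℝ (Fin n)), x⟫ ≤ 1} := by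
    ext x; simp [circumscribed]
  rw [this]
  exact isClosed_biInter fun v _ => isClosed_le (by fun_prop) (by fun_prop)

theorem eventually_add_smul_mem_circumscribed
    {N : Finset (sphere (0 : EuclideanSpace ℝ (Fin n)) 1)} {x d : EuclideanSpace ℝ (Fin n)}
    (hx : x ∈ circumscribed N)
    (h : ∀ v ∈ N, ⟪(v : EuclideanSpace ℝ (Fin n)), x⟫ = 1 →
      ⟪(v : EuclideanSpace ℝ (Fin n)), d⟫ ≤ 0) :
    ∀ᶠ t : ℝ in 𝓝[>] 0, x + t • d ∈ circumscribed N := by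
  refine (Filter.eventually_all_finset N).2 fun v hv => ?_
  rcases (hx v hv).eq_or_lt with h1 | h1
  · filter_upwards [self_mem_nhdsWithin] with t ht
    rw [inner_add_right, inner_smul_right, h1]
    have := mul_nonpos_of_nonneg_of_nonpos (le_of_lt (mem_Ioi.1 ht)) (h v hv h1)
    linarith
  · have hc : Tendsto (fun t : ℝ => ⟪(v : EuclideanSpace ℝ (Fin n)), x + t • d⟫) (𝓝[>] 0)
        (𝓝 ⟪(v : EuclideanSpace ℝ (Fin n)), x + (0 : ℝ) • d⟫) :=
      (Continuous.tendsto (by fun_prop) _).mono_left nhdsWithin_le_nhds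
    rw [zero_smul, add_zero] at hc
    filter_upwards [hc.eventually_lt_const h1] with t ht using ht.le

/-- An extreme point of a polyhedron is determined by the set of its active constraints. -/
theorem finite_extremePoints_circumscribed
    (N : Finset (sphere (0 : EuclideanSpace ℝ (Fin n)) 1)) :
    ((circumscribed N).extremePoints ℝ).Finite := by
  classical
  set act : EuclideanSpace ℝ (Fin n) → Finset (sphere (0 : EuclideanSpace ℝ (Fin n)) 1) :=
    fun x => N.filter fun v => ⟪(v : EuclideanSpace ℝ (Fin n)), x⟫ = 1 with hact
  refine Set.Finite.of_finite_image (f := act) ?_ ?_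
  · refine N.powerset.finite_toSet.subset ?_
    rintro _ ⟨x, -, rfl⟩
    exact Finset.mem_coe.2 (Finset.mem_powerset.2 (Finset.filter_subset _ _))
  · intro x hx y hy hxy
    rw [mem_extremePoints_iff_left] at hx
    have hd : ∀ v ∈ N, ⟪(v : EuclideanSpace ℝ (Fin n)), x⟫ = 1 →
        ⟪(v : EuclideanSpace ℝ (Fin n)), y - x⟫ = 0 := by
      intro v hv h1
      have : v ∈ act y := by rw [← hxy]; simp [hact, hv, h1]
      have h2 : ⟪(v : EuclideanSpace ℝ (Fin n)), y⟫ = 1 := by simpa [hact, hv] using this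
      rw [inner_sub_right, h1, h2, sub_self]
    have e1 := eventually_add_smul_mem_circumscribed hx.1 fun v hv h => (hd v hv h).le
    have e2 := eventually_add_smul_mem_circumscribed (d := -(y - x)) hx.1 fun v hv h => by
      rw [inner_neg_right, hd v hv h, neg_zero]
    obtain ⟨t, ⟨h1, h2⟩, ht⟩ := ((e1.and e2).and self_mem_nhdsWithin).exists
    have h3 := hx.2 _ h1 _ h2 ⟨1 / 2, 1 / 2, by norm_num, by norm_num, by norm_num, by module⟩
    rw [add_eq_left, smul_eq_zero, sub_eq_zero] at h3
    exact (h3.resolve_left (ne_of_gt ht)).symm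

/-- A bounded circumscribed polyhedron is the convex hull of its extreme points, by the
Krein–Milman theorem, hence a polytope. -/
theorem isPolytope_of_coe_eq_circumscribed {K : ConvexBody (EuclideanSpace ℝ (Fin n))}
    {N : Finset (sphere (0 : EuclideanSpace ℝ (Fin n)) 1)}
    (hK : (K : Set (EuclideanSpace ℝ (Fin n))) = circumscribed N) : IsPolytope K := by
  have hfin := finite_extremePoints_circumscribed N
  refine ⟨_, hfin, ?_⟩
  rw [← hfin.isClosed_convexHull (𝕜 := ℝ) |>.closure_eq, ← hK,
    closure_convexHull_extremePoints K.isCompact K.convex]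

/-! ### The normals of a circumscribed polytope -/

/-- If at most the constraint `u` is active at the nearest point of `x`, then `u` is the outer
normal at `x`. -/
theorem outerNormal_eq_of_forall_lt {K : ConvexBody (EuclideanSpace ℝ (Fin n))}
    {N : Finset (sphere (0 : EuclideanSpace ℝ (Fin n)) 1)}
    (hK : (K : Set (EuclideanSpace ℝ (Fin n))) = circumscribed N)
    {x : EuclideanSpace ℝ (Fin n)} (hx : 0 < ‖x - nearest K x‖)
    (u : sphere (0 : EuclideanSpace ℝ (Fin n)) 1)
    (h : ∀ v ∈ N, ⟪(v : EuclideanSpace ℝ (Fin n)), nearest K x⟫ = 1 → v = u) :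
    outerNormal K x = u := by
  set w := outerNormal K x with hw
  have hw1 : ‖w‖ = 1 := norm_outerNormal hx
  have hu1 : ‖(u : EuclideanSpace ℝ (Fin n))‖ = 1 := by simp
  have huw : ⟪(u : EuclideanSpace ℝ (Fin n)), w⟫ ≤ 1 := by
    simpa [hw1, hu1] using real_inner_le_norm (u : EuclideanSpace ℝ (Fin n)) w
  -- `w - u` is a feasible direction at the nearest point, hence it is not ascending along `w`.
  have hmem : nearest K x ∈ circumscribed N := hK ▸ nearest_mem K x
  have hev := eventually_add_smul_mem_circumscribed
      (d := w - (u : EuclideanSpace ℝ (Fin n))) hmem fun v hv h1 => by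
    rw [h v hv h1, inner_sub_right, real_inner_self_eq_norm_sq, hu1]
    linarith
  obtain ⟨t, ht, ht0⟩ := (hev.and self_mem_nhdsWithin).exists
  have h2 := inner_nearest_le K x (hK ▸ ht)
  have hxw : x - nearest K x = ‖x - nearest K x‖ • w := by
    rw [hw, outerNormal, smul_inv_smul₀ hx.ne']
  rw [hxw, add_sub_cancel_left, inner_smul_right, real_inner_smul_left, inner_sub_right,
    real_inner_self_eq_norm_sq, hw1, ← mul_assoc] at h2
  have h3 : 1 - ⟪w, (u : EuclideanSpace ℝ (Fin n))⟫ ≤ 0 := by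
    have := nonpos_of_mul_nonpos_right h2 (mul_pos ht0 hx)
    linarith
  rw [real_inner_comm] at h3
  have h4 : ⟪(u : EuclideanSpace ℝ (Fin n)), w⟫ = 1 := by linarith
  exact ((inner_eq_one_iff_of_norm_eq_one hu1 hw1).1 h4).symm

/-- A point whose outer normal is none of the normals in `N` projects to a face of codimension
two. -/
theorem exists_active_pair {K : ConvexBody (EuclideanSpace ℝ (Fin n))}
    {N : Finset (sphere (0 : EuclideanSpace ℝ (Fin n)) 1)} (hN : N.Nonempty)
    (hK : (K : Set (EuclideanSpace ℝ (Fin n))) = circumscribed N)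
    {x : EuclideanSpace ℝ (Fin n)} (hx : 0 < ‖x - nearest K x‖)
    (hxN : ∀ u ∈ N, outerNormal K x ≠ u) :
    ∃ u ∈ N, ∃ v ∈ N, u ≠ v ∧ ⟪(u : EuclideanSpace ℝ (Fin n)), nearest K x⟫ = 1 ∧
      ⟪(v : EuclideanSpace ℝ (Fin n)), nearest K x⟫ = 1 := by
  have key : ∀ u ∈ N, ∃ v ∈ N, ⟪(v : EuclideanSpace ℝ (Fin n)), nearest K x⟫ = 1 ∧ v ≠ u := by
    intro u hu
    by_contra! h
    exact hxN u hu (outerNormal_eq_of_forall_lt hK hx u h)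
  obtain ⟨w, hw⟩ := hN
  obtain ⟨u, hu, hu1, -⟩ := key w hw
  obtain ⟨v, hv, hv1, hvu⟩ := key u hu
  exact ⟨u, hu, v, hv, hvu.symm, hu1, hv1⟩

/-- In a bounded region, the intersection of two slabs of width `2 * ρ` with independent normals
has volume `O(ρ ^ 2)`. -/
theorem exists_volume_slab_inter_slab_le {u v : EuclideanSpace ℝ (Fin n)}
    (huv : LinearIndependent ℝ ![u, v]) (R : ℝ) :
    ∃ C : ℝ≥0∞, C ≠ ∞ ∧ ∀ ρ : ℝ, volume {x : EuclideanSpace ℝ (Fin n) |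
      |⟪u, x⟫ - 1| ≤ ρ ∧ |⟪v, x⟫ - 1| ≤ ρ ∧ ‖x‖ ≤ R} ≤ C * ENNReal.ofReal ρ ^ 2 := by
  set b := Module.Basis.sumExtend huv with hb
  have hb0 : ∀ k, b (Sum.inl k) = ![u, v] k := fun k => by
    simp only [hb, Module.Basis.sumExtend, Module.Basis.reindex_apply, Module.Basis.extend_apply_self]
    rfl
  have hfin : Fintype (Module.Basis.sumExtendIndex huv) := by
    have := FiniteDimensional.fintypeBasisIndex b
    exact Fintype.sumRight (α := Fin 2)
  set Φ₀ : EuclideanSpace ℝ (Fin n) →ₗ[ℝ] (Fin 2 ⊕ Module.Basis.sumExtendIndex huv → ℝ) :=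
    LinearMap.pi fun k => innerₗ _ (b k) with hΦ₀
  have hinj : Function.Injective Φ₀ := by
    rw [← LinearMap.ker_eq_bot, LinearMap.ker_eq_bot']
    intro x hx
    have h : innerₗ (EuclideanSpace ℝ (Fin n)) x = 0 := b.ext fun k => by
      have := congrFun hx k
      simpa [hΦ₀, real_inner_comm] using this
    simpa using congrArg (fun L => L x) h
  set Φ := (LinearMap.linearEquivOfInjective Φ₀ hinj (by
    rw [Module.finrank_eq_card_basis b, Module.finrank_fintype_fun_eq_card])).toContinuousLinearEquiv
  have hΦ : ∀ x k, Φ x k = ⟪b k, x⟫ := fun x k => rfl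
  set μ := (volume : Measure (EuclideanSpace ℝ (Fin n))).map Φ with hμ
  obtain ⟨c, hμc⟩ : ∃ c : NNReal, μ = c • volume :=
    ⟨_, Measure.isAddLeftInvariant_eq_smul μ volume⟩
  refine ⟨c * (4 * ∏ k : Module.Basis.sumExtendIndex huv,
    ENNReal.ofReal (2 * (‖b (Sum.inr k)‖ * R))), ?_, fun ρ => ?_⟩
  · refine ENNReal.mul_ne_top ENNReal.coe_ne_top (ENNReal.mul_ne_top (by simp) ?_)
    exact ENNReal.prod_ne_top fun k _ => ENNReal.ofReal_ne_top
  · set Q : Set (Fin 2 ⊕ Module.Basis.sumExtendIndex huv → ℝ) := univ.pi (Sum.elim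
      (fun _ => Icc (1 - ρ) (1 + ρ))
      fun k => Icc (-(‖b (Sum.inr k)‖ * R)) (‖b (Sum.inr k)‖ * R)) with hQ
    have hQm : MeasurableSet Q := by
      refine MeasurableSet.univ_pi fun k => ?_
      rcases k with k | k <;> exact measurableSet_Icc
    have hsub : {x : EuclideanSpace ℝ (Fin n) |
        |⟪u, x⟫ - 1| ≤ ρ ∧ |⟪v, x⟫ - 1| ≤ ρ ∧ ‖x‖ ≤ R} ⊆ Φ ⁻¹' Q := by
      rintro x ⟨h1, h2, h3⟩ (k | k) -
      · rw [hΦ, hb0]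
        rw [abs_le] at h1 h2
        fin_cases k
        · exact ⟨by simpa using by linarith [h1.1], by simpa using by linarith [h1.2]⟩
        · exact ⟨by simpa using by linarith [h2.1], by simpa using by linarith [h2.2]⟩
      · rw [hΦ]
        exact abs_le.1 ((abs_real_inner_le_norm _ _).trans (by gcongr))
    have hvolQ : volume Q = (4 * ∏ k : Module.Basis.sumExtendIndex huv,
        ENNReal.ofReal (2 * (‖b (Sum.inr k)‖ * R))) * ENNReal.ofReal ρ ^ 2 := by
      rw [hQ, volume_pi_pi, Fintype.prod_sum_type]
      simp only [Sum.elim_inl, Sum.elim_inr, Real.volume_Icc, Fin.prod_univ_two]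
      have e1 : ENNReal.ofReal (1 + ρ - (1 - ρ)) = 2 * ENNReal.ofReal ρ := by
        rw [show 1 + ρ - (1 - ρ) = 2 * ρ by ring, ENNReal.ofReal_mul (by norm_num)]
        simp
      have e2 : ∀ k : Module.Basis.sumExtendIndex huv,
          ‖b (Sum.inr k)‖ * R - -(‖b (Sum.inr k)‖ * R) = 2 * (‖b (Sum.inr k)‖ * R) :=
        fun k => by ring
      simp only [e1, e2]
      ring
    refine (measure_mono hsub).trans (le_of_eq ?_)
    rw [← Measure.map_apply Φ.continuous.measurable hQm, ← hμ, hμc, Measure.smul_apply, hvolQ,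
      ENNReal.smul_def, smul_eq_mul]
    ring

/-- The surface area measure of a circumscribed polytope is concentrated on the normals of the
polytope: the points of the collar with a different normal lie close to a face of codimension
two. -/
theorem surfaceAreaMeasure_compl_eq_zero {K : ConvexBody (EuclideanSpace ℝ (Fin n))}
    {N : Finset (sphere (0 : EuclideanSpace ℝ (Fin n)) 1)} (hN : N.Nonempty)
    (hK : (K : Set (EuclideanSpace ℝ (Fin n))) = circumscribed N) :
    surfaceAreaMeasure K (N : Set (sphere (0 : EuclideanSpace ℝ (Fin n)) 1))ᶜ = 0 := by
  obtain ⟨R, hR⟩ := K.isCompact.isBounded.exists_norm_le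
  set T : sphere (0 : EuclideanSpace ℝ (Fin n)) 1 → sphere (0 : EuclideanSpace ℝ (Fin n)) 1 → ℝ →
      Set (EuclideanSpace ℝ (Fin n)) := fun u v ρ =>
    {x | |⟪(u : EuclideanSpace ℝ (Fin n)), x⟫ - 1| ≤ ρ ∧
      |⟪(v : EuclideanSpace ℝ (Fin n)), x⟫ - 1| ≤ ρ ∧ ‖x‖ ≤ R + 1} with hT
  have hTC : ∀ p : sphere (0 : EuclideanSpace ℝ (Fin n)) 1 ×
      sphere (0 : EuclideanSpace ℝ (Fin n)) 1, ∃ C : ℝ≥0∞, C ≠ ∞ ∧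
      (LinearIndependent ℝ ![(p.1 : EuclideanSpace ℝ (Fin n)), (p.2 : EuclideanSpace ℝ (Fin n))] →
        ∀ ρ : ℝ, volume (T p.1 p.2 ρ) ≤ C * ENNReal.ofReal ρ ^ 2) := by
    intro p
    by_cases h : LinearIndependent ℝ
        ![(p.1 : EuclideanSpace ℝ (Fin n)), (p.2 : EuclideanSpace ℝ (Fin n))]
    · obtain ⟨C, hC, h'⟩ := exists_volume_slab_inter_slab_le h (R + 1)
      exact ⟨C, hC, fun _ => h'⟩
    · exact ⟨0, by simp, fun h' => absurd h' h⟩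
  choose C hC hCT using hTC
  classical
  set I := (N ×ˢ N).filter fun p => LinearIndependent ℝ
    ![(p.1 : EuclideanSpace ℝ (Fin n)), (p.2 : EuclideanSpace ℝ (Fin n))] with hI
  have hm : MeasurableSet (N : Set (sphere (0 : EuclideanSpace ℝ (Fin n)) 1))ᶜ :=
    N.measurableSet.compl
  have hsub : ∀ ρ : ℝ, ρ ≤ 1 →
      localParallelSet K (N : Set (sphere (0 : EuclideanSpace ℝ (Fin n)) 1))ᶜ ρ ⊆
        ⋃ p ∈ I, T p.1 p.2 ρ := by
    intro ρ hρ x hx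
    rw [mem_localParallelSet_iff] at hx
    obtain ⟨⟨hx0, hxρ⟩, w, hwN, hw⟩ := hx
    obtain ⟨u, hu, v, hv, huv, hu1, hv1⟩ := exists_active_pair hN hK hx0 (by
      rintro u hu h
      exact hwN (by rwa [Subtype.ext (hw.trans h)]))
    have hslab : ∀ u : sphere (0 : EuclideanSpace ℝ (Fin n)) 1,
        ⟪(u : EuclideanSpace ℝ (Fin n)), nearest K x⟫ = 1 →
        |⟪(u : EuclideanSpace ℝ (Fin n)), x⟫ - 1| ≤ ρ := by
      intro u hu1
      have h := abs_real_inner_le_norm (u : EuclideanSpace ℝ (Fin n)) (x - nearest K x)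
      rw [inner_sub_right, hu1] at h
      exact h.trans (by simpa using hxρ)
    have hind : LinearIndependent ℝ
        ![(u : EuclideanSpace ℝ (Fin n)), (v : EuclideanSpace ℝ (Fin n))] := by
      rw [LinearIndependent.pair_iff' (by intro h; simpa [h] using u.2)]
      intro c hc
      have h1 := hv1
      rw [← hc, real_inner_smul_left, hu1, mul_one] at h1
      rw [h1, one_smul] at hc
      exact huv (Subtype.ext hc)
    refine mem_biUnion (show (u, v) ∈ (I : Set _) by simp [hI, hu, hv, hind])
      ⟨hslab u hu1, hslab v hv1, ?_⟩
    have h2 := norm_add_le (x - nearest K x) (nearest K x)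
    rw [sub_add_cancel] at h2
    linarith [hR _ (nearest_mem K x)]
  have hle : ∀ᶠ ρ : ℝ in 𝓝[>] 0,
      volume (localParallelSet K (N : Set (sphere (0 : EuclideanSpace ℝ (Fin n)) 1))ᶜ ρ) /
        ENNReal.ofReal ρ ≤ (∑ p ∈ I, C p) * ENNReal.ofReal ρ := by
    filter_upwards [Ioc_mem_nhdsGT one_pos] with ρ hρ
    refine ENNReal.div_le_of_le_mul ?_
    refine (measure_mono (hsub ρ hρ.2)).trans ((measure_biUnion_finset_le _ _).trans ?_)
    rw [mul_assoc, ← sq, Finset.sum_mul]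
    exact Finset.sum_le_sum fun p hp => hCT p (Finset.mem_filter.1 hp).2 ρ
  have hlim : Tendsto (fun ρ : ℝ => (∑ p ∈ I, C p) * ENNReal.ofReal ρ) (𝓝[>] 0) (𝓝 0) := by
    have hS : (∑ p ∈ I, C p) ≠ ∞ := ENNReal.sum_ne_top.2 fun p _ => hC p
    have h0 : Tendsto (fun ρ : ℝ => ENNReal.ofReal ρ) (𝓝[>] 0) (𝓝 0) := by
      simpa using (ENNReal.continuous_ofReal.tendsto 0).mono_left nhdsWithin_le_nhds
    simpa using ENNReal.Tendsto.const_mul h0 (Or.inr hS)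
  exact le_antisymm (le_of_tendsto_of_tendsto
    (isSurfaceAreaMeasure_surfaceAreaMeasure K _ hm) hlim hle) bot_le

/-- The collar of width `1` over a single direction `u` is covered by `m` translates of the collar
of width `1 / m`. -/
theorem volume_localParallelSet_singleton_le (K : ConvexBody (EuclideanSpace ℝ (Fin n)))
    (u : sphere (0 : EuclideanSpace ℝ (Fin n)) 1) {m : ℕ} (hm : 0 < m) :
    volume (localParallelSet K {u} 1) ≤ m * volume (localParallelSet K {u} (1 / m)) := by
  have hm' : (0 : ℝ) < m := by exact_mod_cast hm
  have hsub : localParallelSet K {u} 1 ⊆ ⋃ k ∈ Finset.range m,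
      (fun x => (-((k : ℝ) / m)) • (u : EuclideanSpace ℝ (Fin n)) + x) ⁻¹'
        localParallelSet K {u} (1 / m) := by
    intro x hx
    rw [mem_localParallelSet_iff, image_singleton, mem_singleton_iff] at hx
    obtain ⟨⟨hx0, hx1⟩, hxu⟩ := hx
    set d := ‖x - nearest K x‖ with hd
    have hxd : x = nearest K x + d • (u : EuclideanSpace ℝ (Fin n)) := by
      rw [← hxu, smul_inv_smul₀ hx0.ne', add_sub_cancel]
    -- The index of the translate is determined by `k < d * m ≤ k + 1`.
    have hc1 : 0 < ⌈d * m⌉₊ := Nat.ceil_pos.2 (by positivity)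
    obtain ⟨k, hk⟩ : ∃ k, ⌈d * m⌉₊ = k + 1 := ⟨_, (Nat.succ_pred_eq_of_pos hc1).symm⟩
    have hk1 : d * m ≤ k + 1 := by
      have := Nat.le_ceil (d * m); rw [hk] at this; exact_mod_cast this
    have hk2 : (k : ℝ) < d * m := by
      refine Nat.lt_ceil.1 ?_; omega
    have hkm : k < m := by
      have : (k : ℝ) < m := hk2.trans_le (by nlinarith)
      exact_mod_cast this
    set t := d - k / m with ht
    have ht0 : 0 < t := sub_pos.2 ((div_lt_iff₀ hm').2 hk2)
    have ht1 : t ≤ 1 / m := by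
      rw [ht, sub_le_iff_le_add, ← add_div, le_div_iff₀ hm']; linarith
    have hy : (-((k : ℝ) / m)) • (u : EuclideanSpace ℝ (Fin n)) + x =
        nearest K x + t • (u : EuclideanSpace ℝ (Fin n)) := by
      nth_rewrite 1 [hxd]; rw [ht]; module
    have hn : nearest K (nearest K x + t • (u : EuclideanSpace ℝ (Fin n))) = nearest K x := by
      have := nearest_ray K x (c := t * d⁻¹) (by positivity)
      rwa [mul_smul, hxu] at this
    refine mem_biUnion (Finset.mem_coe.2 (Finset.mem_range.2 hkm)) ?_
    rw [mem_preimage, hy, mem_localParallelSet_iff, hn, add_sub_cancel_left, norm_smul,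
      Real.norm_of_nonneg ht0.le]
    have hu1 : ‖(u : EuclideanSpace ℝ (Fin n))‖ = 1 := by simp
    rw [hu1, mul_one, inv_smul_smul₀ ht0.ne']
    exact ⟨⟨ht0, ht1⟩, u, rfl, rfl⟩
  refine (measure_mono hsub).trans ((measure_biUnion_finset_le _ _).trans (le_of_eq ?_))
  simp only [measure_preimage_add, Finset.sum_const, Finset.card_range, nsmul_eq_mul]

/-- Over a single direction the collar volume is proportional to the width, so the limit defining
the surface area measure is bounded below by the value at width `1`. -/
theorem volume_localParallelSet_singleton_le_surfaceAreaMeasure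
    (K : ConvexBody (EuclideanSpace ℝ (Fin n)))
    (u : sphere (0 : EuclideanSpace ℝ (Fin n)) 1) :
    volume (localParallelSet K {u} 1) ≤ surfaceAreaMeasure K {u} := by
  have h := (isSurfaceAreaMeasure_surfaceAreaMeasure K {u} (measurableSet_singleton u)).comp
    (tendsto_nhdsWithin_iff.2 ⟨tendsto_one_div_add_atTop_nhds_zero_nat (𝕜 := ℝ),
      Filter.Eventually.of_forall fun m => mem_Ioi.2 Nat.one_div_pos_of_nat⟩)
  refine ge_of_tendsto h (Filter.Eventually.of_forall fun m => ?_)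
  have h1 := volume_localParallelSet_singleton_le K u m.succ_pos
  have hcast : ((m.succ : ℕ) : ℝ≥0∞) = ENNReal.ofReal ((m : ℝ) + 1) := by
    rw [← ENNReal.ofReal_natCast, Nat.cast_succ]
  have hm : (0 : ℝ) < (m : ℝ) + 1 := by positivity
  simp only [Function.comp_apply]
  rw [ENNReal.le_div_iff_mul_le (Or.inl (by simpa using hm)) (Or.inl ENNReal.ofReal_ne_top)]
  rw [hcast, Nat.cast_succ] at h1
  calc _ ≤ _ := mul_le_mul_left h1 _
    _ = volume (localParallelSet K {u} (1 / ((m : ℝ) + 1))) *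
        (ENNReal.ofReal ((m : ℝ) + 1) * ENNReal.ofReal (1 / ((m : ℝ) + 1))) := by
      ring
    _ = _ := by
      rw [← ENNReal.ofReal_mul hm.le, mul_one_div_cancel hm.ne', ENNReal.ofReal_one, mul_one]

/-- Each normal of a circumscribed polytope has positive surface area: near the touching point `u`
only the constraint `u` is active, so the collar over `u` contains an open set. -/
theorem surfaceAreaMeasure_singleton_pos {K : ConvexBody (EuclideanSpace ℝ (Fin n))}
    {N : Finset (sphere (0 : EuclideanSpace ℝ (Fin n)) 1)}
    (hK : (K : Set (EuclideanSpace ℝ (Fin n))) = circumscribed N)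
    {u : sphere (0 : EuclideanSpace ℝ (Fin n)) 1} (hu : u ∈ N) :
    0 < surfaceAreaMeasure K {u} := by
  refine lt_of_lt_of_le ?_ (volume_localParallelSet_singleton_le_surfaceAreaMeasure K u)
  obtain ⟨e, he⟩ : ∃ e : EuclideanSpace ℝ (Fin n), e = u := ⟨_, rfl⟩
  have he1 : ‖e‖ = 1 := by simp [he]
  have hee : ⟪e, e⟫ = 1 := by rw [real_inner_self_eq_norm_sq, he1, one_pow]
  set t : EuclideanSpace ℝ (Fin n) → ℝ := fun y => ⟪e, y⟫ - 1 with ht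
  have htc : Continuous t := by fun_prop
  set O : Set (EuclideanSpace ℝ (Fin n)) := {y | 0 < t y} ∩ {y | t y < 1} ∩
    ⋂ v ∈ {v ∈ N | v ≠ u}, {y | ⟪(v : EuclideanSpace ℝ (Fin n)), y - t y • e⟫ < 1} with hO
  have hOo : IsOpen O := by
    refine ((isOpen_lt continuous_const htc).inter (isOpen_lt htc continuous_const)).inter ?_
    exact isOpen_biInter_finset fun v _ => isOpen_lt (by fun_prop) continuous_const
  have hOn : O.Nonempty := by
    have h1 : t ((3 / 2 : ℝ) • e) = 1 / 2 := by
      simp only [ht, inner_smul_right, hee]; norm_num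
    refine ⟨(3 / 2 : ℝ) • e, ⟨?_, ?_⟩, ?_⟩
    · rw [mem_ofPred_eq, h1]; norm_num
    · rw [mem_ofPred_eq, h1]; norm_num
    · simp only [mem_iInter]
      intro v hv
      rw [Finset.mem_filter] at hv
      rw [mem_ofPred_eq, h1, ← sub_smul, show (3 / 2 - 1 / 2 : ℝ) = 1 by norm_num, one_smul]
      have hv1 : ‖(v : EuclideanSpace ℝ (Fin n))‖ = 1 := by simp
      exact inner_lt_one_iff_real_of_norm_eq_one hv1 he1 |>.2 fun h => hv.2 (Subtype.ext (h.trans he))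
  refine (hOo.measure_pos volume hOn).trans_le (measure_mono ?_)
  rintro y ⟨⟨hy0, hy1⟩, hyv⟩
  simp only [mem_iInter] at hyv
  rw [mem_ofPred_eq] at hy0 hy1
  have hep : ⟪e, y - t y • e⟫ = 1 := by
    rw [inner_sub_right, inner_smul_right, hee, ht]; ring
  have hp : y - t y • e ∈ (K : Set (EuclideanSpace ℝ (Fin n))) := by
    rw [hK]
    intro v hv
    by_cases hvu : v = u
    · rw [hvu, ← he]; exact hep.le
    · exact le_of_lt (hyv v (Finset.mem_filter.2 ⟨hv, hvu⟩))
  have hn : nearest K y = y - t y • e := by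
    refine nearest_eq K hp fun w hw => ?_
    rw [hK] at hw
    rw [sub_sub_cancel, real_inner_smul_left, inner_sub_right, hep]
    exact mul_nonpos_of_nonneg_of_nonpos hy0.le (sub_nonpos.2 (he ▸ hw u hu))
  rw [mem_localParallelSet_iff, hn, sub_sub_cancel, norm_smul, he1, mul_one,
    Real.norm_of_nonneg hy0.le, inv_smul_smul₀ hy0.ne']
  exact ⟨⟨hy0, hy1.le⟩, u, rfl, he.symm⟩

/-! ### Functions whose integrals against polytopes vanish -/

/-- If all integrals of `g` against surface area measures of polytopes vanish, and `g` vanishes at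
all normals of a circumscribed polytope but one, then it vanishes at the remaining one. -/
theorem eq_zero_of_forall_ne_eq_zero {g : sphere (0 : EuclideanSpace ℝ (Fin n)) 1 → ℝ}
    (hg : ∀ P : ConvexBody (EuclideanSpace ℝ (Fin n)), IsPolytope P →
      ∫ u, g u ∂surfaceAreaMeasure P = 0)
    {N : Finset (sphere (0 : EuclideanSpace ℝ (Fin n)) 1)}
    (hb : Bornology.IsBounded (circumscribed N))
    {u : sphere (0 : EuclideanSpace ℝ (Fin n)) 1} (hu : u ∈ N)
    (h : ∀ v ∈ N, v ≠ u → g v = 0) : g u = 0 := by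
  set K : ConvexBody (EuclideanSpace ℝ (Fin n)) :=
    ⟨circumscribed N, convex_circumscribed N,
      isCompact_of_isClosed_isBounded (isClosed_circumscribed N) hb,
      ⟨0, fun v _ => by simp⟩⟩
  have hK : (K : Set (EuclideanSpace ℝ (Fin n))) = circumscribed N := rfl
  have hae : g =ᵐ[surfaceAreaMeasure K] ({u} : Set _).indicator fun _ => g u := by
    have hN : ∀ᵐ v ∂surfaceAreaMeasure K, v ∈ N :=
      ae_iff.2 (surfaceAreaMeasure_compl_eq_zero ⟨u, hu⟩ hK)
    filter_upwards [hN] with v hv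
    by_cases hvu : v = u
    · simp [hvu]
    · rw [indicator_of_notMem (by simpa using hvu), h v hv hvu]
  have h1 := hg K (isPolytope_of_coe_eq_circumscribed hK)
  rw [integral_congr_ae hae, integral_indicator_const _ (measurableSet_singleton u),
    smul_eq_mul] at h1
  refine (mul_eq_zero.1 h1).resolve_left (ne_of_gt ?_)
  exact ENNReal.toReal_pos (surfaceAreaMeasure_singleton_pos hK hu).ne' (measure_ne_top _ _)

/-- The standard basis vectors as points of the unit sphere. -/
noncomputable def stdNormal (i : Fin n) : sphere (0 : EuclideanSpace ℝ (Fin n)) 1 :=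
  ⟨EuclideanSpace.single i 1, by simp⟩

/-- The vector with all coordinates one. -/
def allOnes (n : ℕ) : EuclideanSpace ℝ (Fin n) := WithLp.toLp 2 fun _ => 1

/-- The vector `-(1, …, 1) / √n` is a unit vector. It is the last normal of the simplex whose other
normals are the standard basis vectors; the index `i` ensures that the dimension is positive. -/
theorem neg_smul_allOnes_mem_sphere (i : Fin n) :
    -(‖allOnes n‖⁻¹ • allOnes n) ∈ sphere (0 : EuclideanSpace ℝ (Fin n)) 1 := by
  have h : allOnes n ≠ 0 := fun h => by
    simpa [allOnes] using congrArg (fun x : EuclideanSpace ℝ (Fin n) => x i) h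
  rw [mem_sphere_zero_iff_norm, norm_neg, norm_smul, norm_inv, norm_norm,
    inv_mul_cancel₀ (norm_ne_zero_iff.2 h)]

/-- The inequalities `x i ≤ 1` and `-∑ i, x i ≤ √n` define a simplex, which is bounded. -/
theorem isBounded_circumscribed {N : Finset (sphere (0 : EuclideanSpace ℝ (Fin n)) 1)}
    (hN : ∀ i, stdNormal i ∈ N) {w : sphere (0 : EuclideanSpace ℝ (Fin n)) 1} (hwN : w ∈ N)
    (hw : (w : EuclideanSpace ℝ (Fin n)) = -(‖allOnes n‖⁻¹ • allOnes n)) :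
    Bornology.IsBounded (circumscribed N) := by
  have hpos : 0 < ‖allOnes n‖ := by
    refine lt_of_le_of_ne (norm_nonneg _) fun h => ?_
    have h1 : ‖(w : EuclideanSpace ℝ (Fin n))‖ = 1 := by simp
    rw [hw, ← h] at h1
    simp at h1
  refine isBounded_iff_forall_norm_le.2 ⟨∑ _i : Fin n, (‖allOnes n‖ + n), fun x hx => ?_⟩
  have h1 : ∀ i, x i ≤ 1 := fun i => by
    simpa [stdNormal, EuclideanSpace.inner_single_left] using hx _ (hN i)
  have h2 : -∑ i, x i ≤ ‖allOnes n‖ := by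
    have h := hx w hwN
    rw [hw, inner_neg_left, real_inner_smul_left] at h
    have h3 : ⟪allOnes n, x⟫ = ∑ i, x i := by
      simp [PiLp.inner_apply, allOnes]
    rw [h3, ← mul_neg, inv_mul_le_iff₀ hpos, mul_one] at h
    exact h
  have h3 : ∀ i, |x i| ≤ ‖allOnes n‖ + n := by
    intro i
    have hn : (1 : ℝ) ≤ n := by exact_mod_cast i.pos
    refine abs_le.2 ⟨?_, by linarith [h1 i, hpos]⟩
    have h4 : ∑ j, x j ≤ x i + ∑ j ∈ Finset.univ.erase i, (1 : ℝ) := by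
      rw [← Finset.add_sum_erase _ _ (Finset.mem_univ i)]
      gcongr with j
      exact h1 j
    rw [Finset.sum_const, Finset.card_erase_of_mem (Finset.mem_univ i), Finset.card_univ,
      Fintype.card_fin, nsmul_eq_mul, mul_one] at h4
    have h5 : ((n - 1 : ℕ) : ℝ) ≤ n := by exact_mod_cast Nat.sub_le n 1
    linarith
  have hx' : x = ∑ i, x i • EuclideanSpace.single i (1 : ℝ) := by
    ext j
    simp [Pi.single_apply]
  calc ‖x‖ = ‖∑ i, x i • EuclideanSpace.single i (1 : ℝ)‖ := by rw [← hx']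
    _ ≤ ∑ i, ‖x i • EuclideanSpace.single i (1 : ℝ)‖ := norm_sum_le _ _
    _ ≤ _ := Finset.sum_le_sum fun i _ => by simpa [norm_smul] using h3 i

/-- A function whose integrals against the surface area measures of polytopes all vanish is
linear. -/
theorem exists_eq_inner_of_forall_isPolytope {f : sphere (0 : EuclideanSpace ℝ (Fin n)) 1 → ℝ}
    (hf : ∀ K : ConvexBody (EuclideanSpace ℝ (Fin n)), Integrable f (surfaceAreaMeasure K))
    (hpoly : ∀ P : ConvexBody (EuclideanSpace ℝ (Fin n)), IsPolytope P →
      ∫ u, f u ∂surfaceAreaMeasure P = 0) :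
    ∃ a : EuclideanSpace ℝ (Fin n), ∀ u : sphere (0 : EuclideanSpace ℝ (Fin n)) 1,
      f u = ⟪a, (u : EuclideanSpace ℝ (Fin n))⟫ := by
  classical
  set a : EuclideanSpace ℝ (Fin n) := WithLp.toLp 2 fun i => f (stdNormal i) with ha
  refine ⟨a, fun u => ?_⟩
  set g : sphere (0 : EuclideanSpace ℝ (Fin n)) 1 → ℝ :=
    fun u => f u - ⟪a, (u : EuclideanSpace ℝ (Fin n))⟫ with hg
  have hgP : ∀ P : ConvexBody (EuclideanSpace ℝ (Fin n)), IsPolytope P →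
      ∫ u, g u ∂surfaceAreaMeasure P = 0 := by
    intro P hP
    have hint : Integrable (fun u : sphere (0 : EuclideanSpace ℝ (Fin n)) 1 =>
        ⟪a, (u : EuclideanSpace ℝ (Fin n))⟫) (surfaceAreaMeasure P) :=
      Continuous.integrable_of_hasCompactSupport (by fun_prop)
        (HasCompactSupport.of_compactSpace _)
    rw [integral_sub (hf P) hint, hpoly P hP, integral_inner_surfaceAreaMeasure, sub_zero]
  have hge : ∀ i, g (stdNormal i) = 0 := fun i => by
    simp [hg, ha, stdNormal, EuclideanSpace.inner_single_right]
  obtain ⟨i⟩ : Nonempty (Fin n) := by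
    by_contra! h
    have h1 : ‖(u : EuclideanSpace ℝ (Fin n))‖ = 1 := by simp
    rw [Subsingleton.elim (u : EuclideanSpace ℝ (Fin n)) 0] at h1
    simp at h1
  set w : sphere (0 : EuclideanSpace ℝ (Fin n)) 1 := ⟨_, neg_smul_allOnes_mem_sphere i⟩ with hw
  set N := insert w (Finset.univ.image (stdNormal (n := n))) with hN
  have hNe : ∀ i, stdNormal i ∈ N := fun i => by simp [hN]
  have hNw : w ∈ N := Finset.mem_insert_self _ _
  have hgw : g w = 0 := by
    refine eq_zero_of_forall_ne_eq_zero hgP (isBounded_circumscribed hNe hNw rfl) hNw ?_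
    intro v hv hvw
    obtain ⟨j, -, rfl⟩ := Finset.mem_image.1 ((Finset.mem_insert.1 hv).resolve_left hvw)
    exact hge j
  have hgN : ∀ v ∈ N, g v = 0 := by
    intro v hv
    rcases Finset.mem_insert.1 hv with rfl | hv
    · exact hgw
    · obtain ⟨j, -, rfl⟩ := Finset.mem_image.1 hv
      exact hge j
  have hgu : g u = 0 :=
    eq_zero_of_forall_ne_eq_zero hgP
      (isBounded_circumscribed (N := insert u N) (fun i => Finset.mem_insert_of_mem (hNe i))
        (Finset.mem_insert_of_mem hNw) rfl)
      (Finset.mem_insert_self u N)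
      fun v hv hvu => hgN v ((Finset.mem_insert.1 hv).resolve_left hvu)
  exact sub_eq_zero.1 hgu

end SurfaceArea

theorem mainTheorem6 (n : ℕ) (V : ConvexBody (EuclideanSpace ℝ (Fin n)) → ℝ)
    (hV : SurfaceArea.IsValuation V) (hbdd : SurfaceArea.IsBoundedOnUnitBall V)
    (f : Metric.sphere (0 : EuclideanSpace ℝ (Fin n)) 1 → ℝ)
    (hf : ∀ K : ConvexBody (EuclideanSpace ℝ (Fin n)),
      MeasureTheory.Integrable f (SurfaceArea.surfaceAreaMeasure K))
    (hrep : ∀ K : ConvexBody (EuclideanSpace ℝ (Fin n)),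
      V K = ∫ u, f u ∂(SurfaceArea.surfaceAreaMeasure K))
    (hpoly : ∀ P : ConvexBody (EuclideanSpace ℝ (Fin n)), SurfaceArea.IsPolytope P → V P = 0) :
    Continuous f ∧
      (∃ a : EuclideanSpace ℝ (Fin n),
        ∀ u : Metric.sphere (0 : EuclideanSpace ℝ (Fin n)) 1,
          f u = inner ℝ a (u : EuclideanSpace ℝ (Fin n))) ∧
      ∀ K : ConvexBody (EuclideanSpace ℝ (Fin n)), V K = 0 := by
  obtain ⟨a, ha⟩ := SurfaceArea.exists_eq_inner_of_forall_isPolytope hf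
    fun P hP => (hrep P).symm.trans (hpoly P hP)
  obtain rfl : f = fun u : Metric.sphere (0 : EuclideanSpace ℝ (Fin n)) 1 =>
      inner ℝ a (u : EuclideanSpace ℝ (Fin n)) := funext ha
  exact ⟨by fun_prop, ⟨a, fun _ => rfl⟩,
    fun K => (hrep K).trans (SurfaceArea.integral_inner_surfaceAreaMeasure K a)⟩
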